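/- Let $X$ be a compact metric space, let $d\ge 1$, let $\alpha_1,\dots,\alpha_d$ be pairwise commuting homeomorphisms of $X$, and let $\mu$ be a Borel probability measure on $X$ with $\mu(O)>0$ for every non-empty open $O\subset X$ and $\mu(\alpha_j(E))=\mu(E)$ for every Borel set $E$ and every $j$. Consider the following construction of a Cantor model of $(X,\alpha_1,\dots,\alpha_d)$. (a) Let $\delta_n>0$ $(n=0,1,2,\dots)$ be decreasing with $\delta_n\to0$, and for each $n$ let $Y_{n,1},\dots,Y_{n,l(n)}$ be a partition of $X$ into non-empty Borel sets of diameter less than $\delta_n$ with $\mu(\partial Y_{n,i})=0$ ($\partial$ is the topological boundary), each of the form $Y_{n,i}=O\cup S$ with $O$ open and $S\subset\overline O\setminus O$. Assume that every $Y_{n+1,k}$ is contained in some $Y_{n,i}$ and, for each $j$, in some $\alpha_j^{-1}(Y_{n,i})$. Choose points $x_{n,i}\in Y_{n,i}$. (b) Let $C_0$ be a unital simple AF-algebra with a unique tracial state $\tau$, and let $e_{n,i}\in C_0$ be projections such that $\tau(e_{n,i})=\mu(Y_{n,i})$, $e_{n,i}e_{n,k}=0$ for $i\ne k$, and $e_{n+1,k}\le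 e_{n,i}$ whenever $Y_{n+1,k}\subset Y_{n,i}$. For each $j$ let $\{u_{j,t}\}_{t\in[0,\infty)}$ be a norm continuous path of unitaries in $C_0$ with $$u_{j,t}^*\,e_{n,i}\,u_{j,t}=\sum_{k:\ Y_{n+1,k}\subset\alpha_j^{-1}(Y_{n,i})}e_{n+1,k}\qquad\text{for all } n,\ i \text{ and } t\in[n,n+1].$$ (c) Let $C_{00}\subset C_0$ be the $C^*$-subalgebra generated by all the $e_{n,i}$ (and the unit), let $Y$ be a compact Hausdorff space, and let $h_2:C(Y)\to C_0$ be an injective unital $*$-homomorphism with range $C_{00}$. Let $h_1:C(X)\to C(Y)$ be the unital $*$-homomorphism with $h_2(h_1(f))=\lim_{n\to\infty}\sum_{i=1}^{l(n)}f(x_{n,i})e_{n,i}$ for all $f\in C(X)$, and let $\beta_1,\dots,\beta_d$ be the homeomorphisms of $Y$ that induce the automorphisms $\beta_j^*=\lim_t \mathrm{ad}\,u_{j,t}$, that is, $h_2(g\circ\beta_j)=\lim_{t\to\infty}u_{j,t}^*h_2(g)u_{j,t}$ for all $g\in C(Y)$. Then, for all such choices: (1) If $\alpha_1$ is minimal (every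 orbit $\{\alpha_1^N(x):N\in\mathbb Z\}$ is dense in $X$), then $\beta_1$ is minimal; if, in addition, $X$ is infinite, then $Y$ is homeomorphic to the Cantor set. (2) If there is exactly one $\alpha_1$-invariant Borel probability measure on $X$, then there is exactly one $\beta_1$-invariant Borel probability measure on $Y$. -/

import Mathlib

open Set Filter Topology MeasureTheory

/-- A homeomorphism `φ` is minimal if every (two-sided) orbit is dense; on a compact space this says
that there is no proper non-empty closed `φ`-invariant subset. -/
def IsMinimalHomeo {X : Type*} [TopologicalSpace X] (φ : X ≃ₜ X) : Prop :=
  ∀ x : X, Dense {y : X | ∃ N : ℤ, (φ ^ N) x = y}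

/-- `μ (φ E) = μ E` for every Borel set `E`. -/
def IsInvariantMeasure {X : Type*} [TopologicalSpace X] [MeasurableSpace X]
    (φ : X ≃ₜ X) (μ : Measure X) : Prop :=
  ∀ E : Set X, MeasurableSet E → μ (φ '' E) = μ E

/-- There is exactly one `φ`-invariant Borel probability measure. -/
def HasUniqueInvariantMeasure {X : Type*} [TopologicalSpace X] [MeasurableSpace X]
    (φ : X ≃ₜ X) : Prop :=
  ∃! μ : Measure X, IsProbabilityMeasure μ ∧ IsInvariantMeasure φ μ

/-- A tracial state on a unital C⋆-algebra. -/
structure IsTracialState {A : Type*} [CStarAlgebra A] (τ : A →ₗ[ℂ] ℂ) : Prop where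
  map_one : τ 1 = 1
  nonneg : ∀ a : A, ∃ r : ℝ, 0 ≤ r ∧ τ (star a * a) = (r : ℂ)
  tracial : ∀ a b : A, τ (a * b) = τ (b * a)

/-- A (unital) C⋆-algebra is simple if it is non-zero and has no closed two-sided ideals other than
`0` and itself. -/
def IsSimpleCStarAlgebra (A : Type*) [CStarAlgebra A] : Prop :=
  Nontrivial A ∧ ∀ I : TwoSidedIdeal A, IsClosed (I : Set A) → I = ⊥ ∨ I = ⊤

/-- A unital AF-algebra: the closure of an increasing sequence of finite-dimensional
(unital) ⋆-subalgebras. -/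
def IsUnitalAF (A : Type*) [CStarAlgebra A] : Prop :=
  ∃ F : ℕ → StarSubalgebra ℂ A, Monotone F ∧ (∀ n, FiniteDimensional ℂ (F n)) ∧
    Dense (⋃ n, (F n : Set A))

/-- The sequence of finite Borel partitions `{Y_{n,i}}` of `X` used in the construction: the pieces
of level `n` have diameter less than `δ_n → 0`, have the form "open set together with a part of its
boundary", have `μ`-null topological boundary, and the partition of level `n + 1` refines the
partition of level `n` as well as its preimages under `α_1, …, α_d`. A sample point `x_{n,i}` is
chosen in each piece. -/
structure CantorPartition {X : Type*} [MetricSpace X] [MeasurableSpace X] {d : ℕ}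
    (α : Fin d → X ≃ₜ X) (μ : Measure X) where
  /-- the bounds for the diameters -/
  δ : ℕ → ℝ
  δ_pos : ∀ n, 0 < δ n
  δ_antitone : Antitone δ
  δ_tendsto : Tendsto δ atTop (𝓝 0)
  /-- the number of pieces -/
  l : ℕ → ℕ
  /-- the pieces -/
  Y : (n : ℕ) → Fin (l n) → Set X
  measurableSet : ∀ n i, MeasurableSet (Y n i)
  disjoint : ∀ n i k, i ≠ k → Disjoint (Y n i) (Y n k)
  cover : ∀ n, ⋃ i, Y n i = univ
  diam_lt : ∀ n i, Metric.diam (Y n i) < δ n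
  open_union : ∀ n i, ∃ O S : Set X, IsOpen O ∧ S ⊆ closure O \ O ∧ Y n i = O ∪ S
  frontier_null : ∀ n i, μ (frontier (Y n i)) = 0
  refines : ∀ n k, ∃ i, Y (n + 1) k ⊆ Y n i
  refines_preimage : ∀ n j k, ∃ i, Y (n + 1) k ⊆ α j ⁻¹' Y n i
  /-- the sample points -/
  pt : (n : ℕ) → Fin (l n) → X
  pt_mem : ∀ n i, pt n i ∈ Y n i

open Classical in
/-- The element `∑ e_{n+1,k}`, summed over the pieces `Y_{n+1,k}` contained in `α_j⁻¹(Y_{n,i})`. -/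
noncomputable def CantorPartition.pullback {X : Type*} [MetricSpace X] [MeasurableSpace X] {d : ℕ}
    {α : Fin d → X ≃ₜ X} {μ : Measure X} (P : CantorPartition α μ) {A : Type*} [CStarAlgebra A]
    (e : (n : ℕ) → Fin (P.l n) → A) (n : ℕ) (i : Fin (P.l n)) (j : Fin d) : A :=
  ∑ k ∈ Finset.univ.filter (fun k => P.Y (n + 1) k ⊆ α j ⁻¹' P.Y n i), e (n + 1) k

/-- The choices made in a unital simple AF-algebra `A` with unique tracial state `τ`: projections
`e_{n,i}` of trace `μ(Y_{n,i})`, orthogonal at each level and nested as the pieces are, and, for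
each `j`, a norm continuous path of unitaries `u_{j,t}`, `t ≥ 0`, such that for `t ∈ [n, n + 1]` the
unitary `u_{j,t}` conjugates `e_{n,i}` to the projection that corresponds to `α_j⁻¹(Y_{n,i})`. -/
structure CantorModel {X : Type*} [MetricSpace X] [MeasurableSpace X] {d : ℕ}
    {α : Fin d → X ≃ₜ X} {μ : Measure X} (P : CantorPartition α μ)
    (A : Type*) [CStarAlgebra A] where
  simple : IsSimpleCStarAlgebra A
  af : IsUnitalAF A
  /-- the tracial state -/
  τ : A →ₗ[ℂ] ℂ
  tracial : IsTracialState τ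
  tracial_unique : ∀ σ : A →ₗ[ℂ] ℂ, IsTracialState σ → σ = τ
  /-- the projections -/
  e : (n : ℕ) → Fin (P.l n) → A
  e_proj : ∀ n i, IsStarProjection (e n i)
  e_orth : ∀ n i k, i ≠ k → e n i * e n k = 0
  e_trace : ∀ n i, τ (e n i) = ((μ.real (P.Y n i) : ℝ) : ℂ)
  e_nested : ∀ n i k, P.Y (n + 1) k ⊆ P.Y n i → e n i * e (n + 1) k = e (n + 1) k
  /-- the paths of unitaries -/
  u : Fin d → ℝ → A
  u_unitary : ∀ j t, 0 ≤ t → u j t ∈ unitary A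
  u_continuous : ∀ j, ContinuousOn (u j) (Ici 0)
  u_conj : ∀ (n : ℕ) (i : Fin (P.l n)) (j : Fin d) (t : ℝ), (n : ℝ) ≤ t → t ≤ n + 1 →
    star (u j t) * e n i * u j t = P.pullback e n i j

namespace CantorModel

variable {X : Type*} [MetricSpace X] [MeasurableSpace X] {d : ℕ}
  {α : Fin d → X ≃ₜ X} {μ : Measure X} {P : CantorPartition α μ}
  {A : Type*} [CStarAlgebra A]

/-- The (commutative) C⋆-subalgebra generated by the projections `e_{n,i}`. -/
noncomputable def C00 (M : CantorModel P A) : StarSubalgebra ℂ A :=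
  (StarAlgebra.adjoin ℂ {a : A | ∃ n i, a = M.e n i}).topologicalClosure

/-- `h_n(f) = ∑_i f(x_{n,i}) e_{n,i}`. -/
noncomputable def approx (M : CantorModel P A) (n : ℕ) (f : C(X, ℂ)) : A :=
  ∑ i, f (P.pt n i) • M.e n i

end CantorModel

/-! Under `h₂` the projections `e_{n,i}` become indicators of clopen sets `U n i ⊆ Y`, nested like
the pieces `P.Y n i` and separating points because the `e_{n,i}` generate `C₀₀`
(`CantorModel.isCoding`). So `Y` is a symbolic space over `X`: closures of pieces along an address
shrink to a point, giving a continuous equivariant map `factor : Y → X`, and addresses of points of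
`X` give an equivariant Borel map `sec : X → Y`.

Minimality lifts because `U n i` contains the `factor`-preimage of the non-empty interior of `P.Y n
i` (`mem_of_factor_mem_interior`). For infinite `X`, minimality makes `Y` perfect, and Brouwer's
theorem applies.

By unique ergodicity an invariant `ν` on `Y` pushes forward to `μ`. The frontiers are `μ`-null, so
`sec ∘ factor = id` holds `ν`-almost everywhere (`sec_factor_ae_eq`) and `ν` must be `μ.map sec`. -/

/-! ### Brouwer's characterization of the Cantor set -/

/-- In a perfect zero-dimensional space every non-empty clopen set `W` is divided into two non-empty
parts by a clopen set `D`, in such a way that each part is decided by a given clopen set `C`. -/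
theorem IsClopen.exists_splitting {Y : Type*} [TopologicalSpace Y] [CompactSpace Y] [T2Space Y] [TotallyDisconnectedSpace Y]
    [PerfectSpace Y] {C W : Set Y} (hC : IsClopen C) (hW : IsClopen W) (hne : W.Nonempty) :
    ∃ D : Set Y, IsClopen D ∧ (W ∩ D).Nonempty ∧ (W \ D).Nonempty ∧
      (∀ y ∈ W ∩ D, ∀ z ∈ W ∩ D, y ∈ C → z ∈ C) ∧ ∀ y ∈ W \ D, ∀ z ∈ W \ D, y ∈ C → z ∈ C := by
  by_cases h : (W ∩ C).Nonempty ∧ (W \ C).Nonempty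
  · exact ⟨C, hC, h.1, h.2, fun y _ z hz _ => hz.2, fun y hy z _ hyC => absurd hyC hy.2⟩
  -- Here `W` lies on one side of `C`, so any division will do; perfectness supplies a second point
  -- to split off.
  have hdec : ∀ y ∈ W, ∀ z ∈ W, y ∈ C → z ∈ C := fun y hy z hz hyC => by
    by_contra hzC
    exact h ⟨⟨y, hy, hyC⟩, ⟨z, hz, hzC⟩⟩
  obtain ⟨a, ha⟩ := hne
  obtain ⟨b, hb, hba⟩ : ∃ b ∈ W, b ≠ a := by
    have := (frequently_iff.1 (frequently_mem_iff_neBot.2 (PerfectSpace.not_isolated a)) )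
      (hW.isOpen.mem_nhds ha)
    simpa using this
  obtain ⟨D, hD, hbD, hDa⟩ := compact_exists_isClopen_in_isOpen
    (isOpen_compl_singleton (x := a)) hba
  exact ⟨D, hD, ⟨b, hb, hbD⟩, ⟨a, ha, fun h => hDa h rfl⟩,
    fun y hy z hz => hdec y hy.1 z hz.1, fun y hy z hz => hdec y hy.1 z hz.1⟩

open Classical in
/-- The cell of depth `n` that is addressed by `x`, when the splitting set `D n W` is used to divide
a cell `W` of depth `n`. -/
noncomputable def splitCell {Y : Type*} (D : ℕ → Set Y → Set Y) (x : ℕ → Bool) : ℕ → Set Y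
  | 0 => univ
  | n + 1 => if x n then splitCell D x n ∩ D n (splitCell D x n)
      else splitCell D x n \ D n (splitCell D x n)

open Classical in
/-- The cell of depth `n` that contains `y`. -/
noncomputable def pointCell {Y : Type*} (D : ℕ → Set Y → Set Y) (y : Y) : ℕ → Set Y
  | 0 => univ
  | n + 1 => if y ∈ D n (pointCell D y n) then pointCell D y n ∩ D n (pointCell D y n)
      else pointCell D y n \ D n (pointCell D y n)

open Classical in
/-- The address of the point `y`. -/
noncomputable def pointAddress {Y : Type*} (D : ℕ → Set Y → Set Y) (y : Y) (n : ℕ) : Bool :=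
  decide (y ∈ D n (pointCell D y n))

theorem mem_pointCell {Y : Type*} (D : ℕ → Set Y → Set Y) (y : Y) (n : ℕ) : y ∈ pointCell D y n := by
  induction n with
  | zero => trivial
  | succ n ih =>
    rw [pointCell]
    split_ifs with h
    exacts [⟨ih, h⟩, ⟨ih, h⟩]

theorem splitCell_pointAddress {Y : Type*} (D : ℕ → Set Y → Set Y) (y : Y) (n : ℕ) :
    splitCell D (pointAddress D y) n = pointCell D y n := by
  induction n with
  | zero => rfl
  | succ n ih =>
    by_cases h : y ∈ D n (pointCell D y n) <;> simp [splitCell, pointCell, ih, pointAddress, h]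

theorem splitCell_succ_subset {Y : Type*} (D : ℕ → Set Y → Set Y) (x : ℕ → Bool) (n : ℕ) :
    splitCell D x (n + 1) ⊆ splitCell D x n := by
  rw [splitCell]
  split_ifs
  exacts [inter_subset_left, sdiff_subset]

/-- Cells of equal depth are disjoint or equal, since each division is into disjoint halves. -/
theorem pointCell_eq_splitCell {Y : Type*} {D : ℕ → Set Y → Set Y} {x : ℕ → Bool} {y : Y} {n : ℕ}
    (h : y ∈ splitCell D x n) : pointCell D y n = splitCell D x n := by
  induction n with
  | zero => rfl
  | succ n ih =>
    have hn := ih (splitCell_succ_subset D x n h)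
    rw [splitCell] at h ⊢
    rw [pointCell, hn]
    split_ifs at h ⊢ with h₁
    exacts [rfl, absurd h₁ h.2, absurd h.2 h₁, rfl]

theorem pointAddress_eq {Y : Type*} {D : ℕ → Set Y → Set Y} {x : ℕ → Bool} {y : Y} {n : ℕ}
    (h : y ∈ splitCell D x (n + 1)) : pointAddress D y n = x n := by
  have hn := pointCell_eq_splitCell (splitCell_succ_subset D x n h)
  rw [splitCell] at h
  rw [pointAddress, hn]
  split_ifs at h with h₁
  · simpa [h₁] using h.2
  · simpa [h₁] using h.2

/-- Brouwer's characterization of the Cantor set: a non-empty compact Hausdorff space that is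
totally disconnected, second countable and perfect is homeomorphic to the Cantor space. -/
theorem nonempty_homeomorph_nat_bool {Y : Type*} [TopologicalSpace Y] [CompactSpace Y] [T2Space Y] [TotallyDisconnectedSpace Y]
    [SecondCountableTopology Y] [PerfectSpace Y] [Nonempty Y] :
    Nonempty (Y ≃ₜ (ℕ → Bool)) := by
  have : Countable (TopologicalSpace.Clopens Y) :=
    TopologicalSpace.Clopens.countable_iff_secondCountable.2 inferInstance
  obtain ⟨C, hCsurj⟩ := exists_surjective_nat (TopologicalSpace.Clopens Y)
  -- `C` enumerates all clopen sets, and division `n` makes every cell decide `C n`. Points with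
  -- equal addresses then lie in the same clopen sets, whence injectivity.
  have key : ∀ (n : ℕ) (W : Set Y), ∃ D : Set Y, IsClopen W → W.Nonempty → IsClopen D ∧
      (W ∩ D).Nonempty ∧ (W \ D).Nonempty ∧
      (∀ y ∈ W ∩ D, ∀ z ∈ W ∩ D, y ∈ C n → z ∈ C n) ∧
      ∀ y ∈ W \ D, ∀ z ∈ W \ D, y ∈ C n → z ∈ C n := fun n W => by
    by_cases h : IsClopen W ∧ W.Nonempty
    · obtain ⟨D, hD⟩ := (C n).isClopen.exists_splitting h.1 h.2
      exact ⟨D, fun _ _ => hD⟩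
    · exact ⟨∅, fun h₁ h₂ => absurd ⟨h₁, h₂⟩ h⟩
  choose D hD using key
  have hcell : ∀ x n, IsClopen (splitCell D x n) ∧ (splitCell D x n).Nonempty := fun x n => by
    induction n with
    | zero => exact ⟨isClopen_univ, univ_nonempty⟩
    | succ n ih =>
      obtain ⟨h₁, h₂, h₃, -⟩ := hD n _ ih.1 ih.2
      rw [splitCell]
      split_ifs
      exacts [⟨ih.1.inter h₁, h₂⟩, ⟨ih.1.diff h₁, h₃⟩]
  have hcont : Continuous (pointAddress D) := by
    refine continuous_pi fun n => continuous_iff_continuousAt.2 fun y => ?_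
    have hy : y ∈ splitCell D (pointAddress D y) (n + 1) := by
      rw [splitCell_pointAddress]
      exact mem_pointCell D y _
    -- Digit `n` is constant on each clopen cell of depth `n + 1`.
    exact continuousAt_const.congr (Filter.mem_of_superset ((hcell _ _).1.isOpen.mem_nhds hy)
      fun z hz => (pointAddress_eq hz).symm)
  have hinj : Function.Injective (pointAddress D) := fun y z hyz => by
    by_contra hne
    obtain ⟨V, hV, hyV, hVz⟩ := compact_exists_isClopen_in_isOpen
      (isOpen_compl_singleton (x := z)) hne
    obtain ⟨n, hn⟩ := hCsurj ⟨V, hV⟩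
    have hCV : (C n : Set Y) = V := by rw [hn]; rfl
    obtain ⟨-, -, -, h₁, h₂⟩ := hD n _ (hcell (pointAddress D y) n).1 (hcell _ n).2
    have hy : y ∈ splitCell D (pointAddress D y) (n + 1) := by
      rw [splitCell_pointAddress]
      exact mem_pointCell D y _
    have hz : z ∈ splitCell D (pointAddress D y) (n + 1) := by
      rw [hyz, splitCell_pointAddress]
      exact mem_pointCell D z _
    have hyC : y ∈ (C n : Set Y) := hCV ▸ hyV
    have hzC : z ∈ (C n : Set Y) := by
      rw [splitCell] at hy hz
      split_ifs at hy hz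
      exacts [h₁ y hy z hz hyC, h₂ y hy z hz hyC]
    exact hVz (hCV ▸ hzC) rfl
  have hsurj : Function.Surjective (pointAddress D) := fun x => by
    obtain ⟨y, hy⟩ := IsCompact.nonempty_iInter_of_sequence_nonempty_isCompact_isClosed
      (splitCell D x) (splitCell_succ_subset D x) (fun n => (hcell x n).2)
      (hcell x 0).1.isClosed.isCompact (fun n => (hcell x n).1.isClosed)
    exact ⟨y, funext fun n => pointAddress_eq (mem_iInter.1 hy (n + 1))⟩
  exact ⟨Continuous.homeoOfEquivCompactToT2 (f := Equiv.ofBijective _ ⟨hinj, hsurj⟩) hcont⟩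

/-! ### Minimality and invariant measures of homeomorphisms -/

section Homeo

variable {X : Type*} [TopologicalSpace X]

/-- Every orbit meets the open point `x`, so every point is the preimage of `x` under some power and
hence open. -/
theorem IsMinimalHomeo.finite_of_isOpen_singleton [CompactSpace X] {φ : X ≃ₜ X}
    (hφ : IsMinimalHomeo φ) {x : X} (hx : IsOpen ({x} : Set X)) : Finite X := by
  have : DiscreteTopology X := discreteTopology_iff_isOpen_singleton.2 fun z => by
    obtain ⟨y, hy, N, hN⟩ := (hφ z).inter_open_nonempty {x} hx ⟨x, rfl⟩
    obtain rfl : y = x := hy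
    have : ({z} : Set X) = (φ ^ N) ⁻¹' {y} := by
      ext w
      rw [mem_preimage, mem_singleton_iff, mem_singleton_iff, ← hN, (φ ^ N).injective.eq_iff]
    rw [this]
    exact hx.preimage (φ ^ N).continuous
  exact finite_of_compact_of_discrete

theorem IsMinimalHomeo.perfectSpace [CompactSpace X] [Infinite X] {φ : X ≃ₜ X}
    (hφ : IsMinimalHomeo φ) : PerfectSpace X := by
  refine perfectSpace_iff_forall_not_isolated.2 fun x => neBot_iff.2 fun h => ?_
  have := hφ.finite_of_isOpen_singleton (isOpen_singleton_iff_punctured_nhds x |>.2 h)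
  exact not_finite X

/-- A map that intertwines two homeomorphisms intertwines their integer powers. -/
theorem Homeomorph.semiconj_zpow {Y : Type*} [TopologicalSpace Y] {p : Y → X} {ψ : Y ≃ₜ Y}
    {φ : X ≃ₜ X} (h : ∀ y, p (ψ y) = φ (p y)) (N : ℤ) (y : Y) :
    p ((ψ ^ N) y) = (φ ^ N) (p y) := by
  have hinv : ∀ y, p (ψ⁻¹ y) = φ⁻¹ (p y) := fun y => by
    apply φ.injective
    rw [← h]
    exact (congrArg p (ψ.apply_symm_apply y)).trans (φ.apply_symm_apply (p y)).symm
  induction N generalizing y with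
  | zero => rfl
  | succ n ih => rw [zpow_add_one, zpow_add_one, Homeomorph.mul_apply, Homeomorph.mul_apply, ih, h]
  | pred n ih =>
    rw [zpow_sub_one, zpow_sub_one, Homeomorph.mul_apply, Homeomorph.mul_apply, ih, hinv]

theorem isInvariantMeasure_iff_map_eq [MeasurableSpace X] [BorelSpace X] {φ : X ≃ₜ X}
    {μ : Measure X} : IsInvariantMeasure φ μ ↔ μ.map φ = μ := by
  refine ⟨fun h => Measure.ext fun E hE => ?_, fun h E hE => ?_⟩
  · rw [Measure.map_apply φ.measurable hE, ← h _ (φ.measurable hE),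
      image_preimage_eq _ φ.surjective]
  · have hE' : MeasurableSet (φ '' E) := φ.toMeasurableEquiv.measurableSet_image.2 hE
    rw [← h, Measure.map_apply φ.measurable hE', preimage_image_eq _ φ.injective, h]

end Homeo

/-! ### Combinatorics of the partitions of `X` -/

namespace CantorPartition

variable {X : Type*} [MetricSpace X] [MeasurableSpace X] {d : ℕ} {α : Fin d → X ≃ₜ X}
  {μ : Measure X} (P : CantorPartition α μ)

theorem exists_mem (n : ℕ) (x : X) : ∃ i, x ∈ P.Y n i :=
  mem_iUnion.1 (P.cover n ▸ mem_univ x)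

theorem eq_of_mem {n : ℕ} {i k : Fin (P.l n)} {x : X} (hi : x ∈ P.Y n i) (hk : x ∈ P.Y n k) :
    i = k := by
  by_contra h
  exact (P.disjoint n i k h).le_bot ⟨hi, hk⟩

theorem exists_subset {n m : ℕ} (h : n ≤ m) (k : Fin (P.l m)) : ∃ i, P.Y m k ⊆ P.Y n i := by
  induction m, h using Nat.le_induction with
  | base => exact ⟨k, Subset.rfl⟩
  | succ m _ ih =>
    obtain ⟨k', hk'⟩ := P.refines m k
    obtain ⟨i, hi⟩ := ih k'
    exact ⟨i, hk'.trans hi⟩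

theorem subset_of_mem {n m : ℕ} (h : n ≤ m) {i : Fin (P.l n)} {k : Fin (P.l m)} {x : X}
    (hi : x ∈ P.Y n i) (hk : x ∈ P.Y m k) : P.Y m k ⊆ P.Y n i := by
  obtain ⟨i', hi'⟩ := P.exists_subset h k
  rwa [P.eq_of_mem hi (hi' hk)]

theorem subset_preimage_of_mem {n : ℕ} {j : Fin d} {i : Fin (P.l n)} {k : Fin (P.l (n + 1))} {x : X}
    (hi : α j x ∈ P.Y n i) (hk : x ∈ P.Y (n + 1) k) : P.Y (n + 1) k ⊆ α j ⁻¹' P.Y n i := by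
  obtain ⟨i', hi'⟩ := P.refines_preimage n j k
  rwa [P.eq_of_mem hi (hi' hk)]

/-- If the open part `O` were empty, then `S ⊆ closure O` would be empty too, contradicting the
sample point. -/
theorem nonempty_interior (n : ℕ) (i : Fin (P.l n)) : (interior (P.Y n i)).Nonempty := by
  obtain ⟨O, S, hO, hS, h⟩ := P.open_union n i
  have hO' : O.Nonempty := by
    by_contra hne
    rw [not_nonempty_iff_eq_empty] at hne
    have := P.pt_mem n i
    rw [h, hne] at this
    rcases this with h' | h'
    · exact h'
    · simpa [hne] using (hS h').1
  exact hO'.mono (interior_maximal (h ▸ subset_union_left) hO)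

theorem dist_le [CompactSpace X] {n : ℕ} {i : Fin (P.l n)} {x y : X} (hx : x ∈ closure (P.Y n i))
    (hy : y ∈ closure (P.Y n i)) : dist x y ≤ P.δ n := by
  have hb : Bornology.IsBounded (closure (P.Y n i)) := isClosed_closure.isCompact.isBounded
  exact ((Metric.dist_le_diam_of_mem hb hx hy).trans_eq (Metric.diam_closure _)).trans
    (P.diam_lt n i).le

theorem eq_of_forall_dist_le {x y : X} (h : ∀ n, dist x y ≤ P.δ n) : x = y :=
  dist_le_zero.1 (ge_of_tendsto' P.δ_tendsto h)

end CantorPartition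

/-! ### Symbolic coding: the maps between `X` and `Y` -/

/-- The sets `U n i` form a sequence of partitions of `Y` into non-empty clopen sets that are nested
as the sets `P.Y n i` are, and that separate the points of `Y`. -/
structure CantorPartition.IsCoding {X : Type*} [MetricSpace X] [MeasurableSpace X] {d : ℕ}
    {α : Fin d → X ≃ₜ X} {μ : Measure X} (P : CantorPartition α μ) {Y : Type*} [TopologicalSpace Y]
    (U : (n : ℕ) → Fin (P.l n) → Set Y) : Prop where
  isClopen : ∀ n i, IsClopen (U n i)
  nonempty : ∀ n i, (U n i).Nonempty
  eq_of_mem : ∀ {n i k y}, y ∈ U n i → y ∈ U n k → i = k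
  exists_mem : ∀ n y, ∃ i, y ∈ U n i
  nested : ∀ n i k, P.Y (n + 1) k ⊆ P.Y n i → U (n + 1) k ⊆ U n i
  separates : ∀ y z, (∀ n i, y ∈ U n i → z ∈ U n i) → y = z

namespace CantorPartition.IsCoding

variable {X : Type*} [MetricSpace X] [MeasurableSpace X] {d : ℕ} {α : Fin d → X ≃ₜ X}
  {μ : Measure X} {P : CantorPartition α μ} {Y : Type*} [TopologicalSpace Y]
  {U : (n : ℕ) → Fin (P.l n) → Set Y}

theorem subset_of_subset (hU : P.IsCoding U) {n m : ℕ} (h : n ≤ m) {i : Fin (P.l n)}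
    {k : Fin (P.l m)} (hki : P.Y m k ⊆ P.Y n i) : U m k ⊆ U n i := by
  induction m, h using Nat.le_induction with
  | base => rw [P.eq_of_mem (P.pt_mem n k) (hki (P.pt_mem n k))]
  | succ m hm ih =>
    obtain ⟨k', hk'⟩ := P.refines m k
    exact (hU.nested m k' k hk').trans
      (ih (P.subset_of_mem hm (hki (P.pt_mem _ k)) (hk' (P.pt_mem _ k))))

theorem subset_of_mem (hU : P.IsCoding U) {n m : ℕ} (h : n ≤ m) {i : Fin (P.l n)}
    {k : Fin (P.l m)} {y : Y} (hi : y ∈ U n i) (hk : y ∈ U m k) : P.Y m k ⊆ P.Y n i := by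
  obtain ⟨i', hi'⟩ := P.exists_subset h k
  rwa [hU.eq_of_mem hi (hU.subset_of_subset h hi' hk)]

/-- Every decreasing chain of sets `P.Y n i` addresses a point of `Y`. -/
theorem exists_section [CompactSpace Y] (hU : P.IsCoding U) (x : X) :
    ∃ y : Y, ∀ n i, x ∈ P.Y n i → y ∈ U n i := by
  choose c hc using fun n => P.exists_mem n x
  obtain ⟨y, hy⟩ := IsCompact.nonempty_iInter_of_sequence_nonempty_isCompact_isClosed
    (fun n => U n (c n))
    (fun n => hU.nested n _ _ (P.subset_of_mem n.le_succ (hc n) (hc (n + 1))))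
    (fun n => hU.nonempty n _) (hU.isClopen _ _).isClosed.isCompact
    (fun n => (hU.isClopen _ _).isClosed)
  exact ⟨y, fun n i hi => P.eq_of_mem (hc n) hi ▸ mem_iInter.1 hy n⟩

/-- Every point of `Y` addresses a point of `X`. -/
theorem exists_factor [CompactSpace X] (hU : P.IsCoding U) (y : Y) :
    ∃ x : X, ∀ n i, y ∈ U n i → x ∈ closure (P.Y n i) := by
  choose c hc using fun n => hU.exists_mem n y
  obtain ⟨x, hx⟩ := IsCompact.nonempty_iInter_of_sequence_nonempty_isCompact_isClosed
    (fun n => closure (P.Y n (c n)))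
    (fun n => closure_mono (hU.subset_of_mem n.le_succ (hc n) (hc (n + 1))))
    (fun n => ⟨_, subset_closure (P.pt_mem n _)⟩) isClosed_closure.isCompact
    (fun n => isClosed_closure)
  exact ⟨x, fun n i hi => hU.eq_of_mem (hc n) hi ▸ mem_iInter.1 hx n⟩

/-- The map that sends a point of `X` to the point of `Y` with the same address. -/
noncomputable def sec [CompactSpace Y] (hU : P.IsCoding U) (x : X) : Y :=
  (hU.exists_section x).choose

theorem sec_mem [CompactSpace Y] (hU : P.IsCoding U) {x : X} {n : ℕ} {i : Fin (P.l n)}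
    (hx : x ∈ P.Y n i) : hU.sec x ∈ U n i :=
  (hU.exists_section x).choose_spec n i hx

theorem sec_mem_iff [CompactSpace Y] (hU : P.IsCoding U) {x : X} {n : ℕ} {i : Fin (P.l n)} :
    hU.sec x ∈ U n i ↔ x ∈ P.Y n i := by
  refine ⟨fun h => ?_, hU.sec_mem⟩
  obtain ⟨k, hk⟩ := P.exists_mem n x
  rwa [hU.eq_of_mem h (hU.sec_mem hk)]

/-- The factor map `Y → X`. -/
noncomputable def factor [CompactSpace X] (hU : P.IsCoding U) (y : Y) : X :=
  (hU.exists_factor y).choose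

theorem factor_mem [CompactSpace X] (hU : P.IsCoding U) {y : Y} {n : ℕ} {i : Fin (P.l n)}
    (hy : y ∈ U n i) : hU.factor y ∈ closure (P.Y n i) :=
  (hU.exists_factor y).choose_spec n i hy

theorem continuous_factor [CompactSpace X] (hU : P.IsCoding U) : Continuous hU.factor := by
  refine Metric.continuous_iff'.2 fun y ε hε => ?_
  obtain ⟨n, hn⟩ := (P.δ_tendsto.eventually_lt_const hε).exists
  obtain ⟨i, hi⟩ := hU.exists_mem n y
  filter_upwards [(hU.isClopen n i).isOpen.mem_nhds hi] with z hz
  exact (P.dist_le (hU.factor_mem hz) (hU.factor_mem hi)).trans_lt hn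

/-- At a deep level `m`, the piece addressed by `y` is so small and so close to `factor y` that its
sample point lies in `P.Y n i`; nesting then puts `U m k` inside `U n i`. -/
theorem mem_of_factor_mem_interior [CompactSpace X] (hU : P.IsCoding U) {y : Y} {n : ℕ}
    {i : Fin (P.l n)} (hy : hU.factor y ∈ interior (P.Y n i)) : y ∈ U n i := by
  obtain ⟨ε, hε, hball⟩ := Metric.isOpen_iff.1 isOpen_interior _ hy
  obtain ⟨m, hm, hnm⟩ :=
    ((P.δ_tendsto.eventually_lt_const hε).and (eventually_ge_atTop n)).exists
  obtain ⟨k, hk⟩ := hU.exists_mem m y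
  have hpt : P.pt m k ∈ P.Y n i := interior_subset <| hball <|
    (P.dist_le (subset_closure (P.pt_mem m k)) (hU.factor_mem hk)).trans_lt hm
  exact hU.subset_of_subset hnm (P.subset_of_mem hnm hpt (P.pt_mem m k)) hk

/-- The sets `U n i` containing `y` decrease to `{y}`. If none were inside `O`, compactness would
give a point outside `O` with the address of `y`. -/
theorem exists_subset_of_isOpen [CompactSpace Y] (hU : P.IsCoding U) {y : Y} {O : Set Y}
    (hO : IsOpen O) (hy : y ∈ O) : ∃ n i, y ∈ U n i ∧ U n i ⊆ O := by
  choose c hc using fun n => hU.exists_mem n y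
  have hmono : ∀ n, U (n + 1) (c (n + 1)) ⊆ U n (c n) := fun n =>
    hU.nested n _ _ (hU.subset_of_mem n.le_succ (hc n) (hc (n + 1)))
  by_contra! hcon
  obtain ⟨z, hz⟩ := IsCompact.nonempty_iInter_of_sequence_nonempty_isCompact_isClosed
    (fun n => U n (c n) ∩ Oᶜ) (fun n => inter_subset_inter_left _ (hmono n))
    (fun n => by
      obtain ⟨z, hz, hzO⟩ := not_subset.1 (hcon n (c n) (hc n))
      exact ⟨z, hz, hzO⟩)
    ((hU.isClopen _ _).isClosed.inter hO.isClosed_compl).isCompact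
    (fun n => (hU.isClopen _ _).isClosed.inter hO.isClosed_compl)
  obtain rfl : y = z := hU.separates y z fun n i hi =>
    hU.eq_of_mem (hc n) hi ▸ (mem_iInter.1 hz n).1
  exact (mem_iInter.1 hz 0).2 hy

theorem isTopologicalBasis [CompactSpace Y] (hU : P.IsCoding U) :
    TopologicalSpace.IsTopologicalBasis (range fun p : Σ n, Fin (P.l n) => U p.1 p.2) := by
  refine TopologicalSpace.isTopologicalBasis_of_isOpen_of_nhds ?_ fun y O hy hO => ?_
  · rintro _ ⟨p, rfl⟩
    exact (hU.isClopen _ _).isOpen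
  · obtain ⟨n, i, h⟩ := hU.exists_subset_of_isOpen hO hy
    exact ⟨_, ⟨⟨n, i⟩, rfl⟩, h⟩

theorem secondCountableTopology [CompactSpace Y] (hU : P.IsCoding U) :
    SecondCountableTopology Y :=
  hU.isTopologicalBasis.secondCountableTopology (countable_range _)

theorem totallyDisconnectedSpace (hU : P.IsCoding U) : TotallyDisconnectedSpace Y := by
  have : TotallySeparatedSpace Y := totallySeparatedSpace_iff_exists_isClopen.2 fun y z hyz => by
    by_contra! h
    exact hyz (hU.separates y z fun n i hi => by
      by_contra hz
      exact h _ (hU.isClopen n i) hi hz)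
  infer_instance

/-! ### Lifting minimality and unique ergodicity -/

section Dynamics

variable {j : Fin d} {ψ : Y ≃ₜ Y}

theorem sec_semiconj [CompactSpace Y] (hU : P.IsCoding U)
    (hψ : ∀ n i k, P.Y (n + 1) k ⊆ α j ⁻¹' P.Y n i → U (n + 1) k ⊆ ψ ⁻¹' U n i) (x : X) :
    hU.sec (α j x) = ψ (hU.sec x) := by
  refine hU.separates _ _ fun n i hi => ?_
  rw [hU.sec_mem_iff] at hi
  obtain ⟨k, hk⟩ := P.exists_mem (n + 1) x
  exact hψ n i k (P.subset_preimage_of_mem hi hk) (hU.sec_mem hk)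

/-- At every level both sides lie in the closure of one common piece, so their distance is at most
`P.δ n`. -/
theorem factor_semiconj [CompactSpace X] (hU : P.IsCoding U)
    (hψ : ∀ n i k, P.Y (n + 1) k ⊆ α j ⁻¹' P.Y n i → U (n + 1) k ⊆ ψ ⁻¹' U n i) (y : Y) :
    hU.factor (ψ y) = α j (hU.factor y) := by
  refine P.eq_of_forall_dist_le fun n => ?_
  obtain ⟨k, hk⟩ := hU.exists_mem (n + 1) y
  obtain ⟨i, hi⟩ := P.refines_preimage n j k
  refine P.dist_le (hU.factor_mem (hψ n i k hi hk)) ?_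
  exact (map_mem_closure (α j).continuous (hU.factor_mem hk) hi)

theorem isMinimalHomeo [CompactSpace X] [CompactSpace Y] (hU : P.IsCoding U)
    (hψ : ∀ n i k, P.Y (n + 1) k ⊆ α j ⁻¹' P.Y n i → U (n + 1) k ⊆ ψ ⁻¹' U n i)
    (hα : IsMinimalHomeo (α j)) : IsMinimalHomeo ψ := by
  refine fun y => dense_iff_inter_open.2 fun O hO ⟨z, hz⟩ => ?_
  obtain ⟨n, i, -, hnO⟩ := hU.exists_subset_of_isOpen hO hz
  obtain ⟨_, hx, N, rfl⟩ := (hα (hU.factor y)).inter_open_nonempty _ isOpen_interior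
    (P.nonempty_interior n i)
  rw [← Homeomorph.semiconj_zpow (hU.factor_semiconj hψ)] at hx
  exact ⟨_, hnO (hU.mem_of_factor_mem_interior hx), N, rfl⟩

/-- If `Y` were finite, the range of `factor` would be finite, hence closed, yet it contains a dense
orbit of the infinite space `X`. -/
theorem infinite [CompactSpace X] [Infinite X] (hU : P.IsCoding U)
    (hψ : ∀ n i k, P.Y (n + 1) k ⊆ α j ⁻¹' P.Y n i → U (n + 1) k ⊆ ψ ⁻¹' U n i)
    (hα : IsMinimalHomeo (α j)) [Nonempty Y] : Infinite Y := by
  by_contra hY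
  rw [not_infinite_iff_finite] at hY
  obtain ⟨y⟩ := ‹Nonempty Y›
  have hsub : {x | ∃ N : ℤ, (α j ^ N) (hU.factor y) = x} ⊆ range hU.factor := by
    rintro _ ⟨N, rfl⟩
    exact ⟨_, Homeomorph.semiconj_zpow (hU.factor_semiconj hψ) N y⟩
  have hfin : (range hU.factor).Finite := finite_range _
  have huniv := ((hα _).mono hsub).closure_eq
  rw [hfin.isClosed.closure_eq] at huniv
  exact infinite_univ (huniv ▸ hfin)

theorem nonempty_homeomorph_cantorSet [CompactSpace X] [CompactSpace Y] [T2Space Y] [Infinite X]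
    (hU : P.IsCoding U)
    (hψ : ∀ n i k, P.Y (n + 1) k ⊆ α j ⁻¹' P.Y n i → U (n + 1) k ⊆ ψ ⁻¹' U n i)
    (hα : IsMinimalHomeo (α j)) : Nonempty (Y ≃ₜ cantorSet) := by
  have : Nonempty Y := ⟨hU.sec (Classical.arbitrary X)⟩
  have := hU.infinite hψ hα
  have := (hU.isMinimalHomeo hψ hα).perfectSpace
  have := hU.secondCountableTopology
  have := hU.totallyDisconnectedSpace
  obtain ⟨f⟩ := nonempty_homeomorph_nat_bool (Y := Y)
  exact ⟨f.trans cantorSetHomeomorphNatToBool.symm⟩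

theorem measurable_sec [CompactSpace Y] [MeasurableSpace Y] [BorelSpace Y] (hU : P.IsCoding U) :
    Measurable hU.sec := by
  have := hU.secondCountableTopology
  rw [BorelSpace.measurable_eq (α := Y), hU.isTopologicalBasis.borel_eq_generateFrom]
  refine measurable_generateFrom ?_
  rintro _ ⟨p, rfl⟩
  convert P.measurableSet p.1 p.2 using 1
  exact ext fun x => hU.sec_mem_iff

/-- Outside countably many null sets, `factor y` avoids all frontiers. Being in the closure of each
piece addressed by `y`, it then lies in the piece itself and has the address of `y`. -/
theorem sec_factor_ae_eq [BorelSpace X] [CompactSpace X] [CompactSpace Y] [MeasurableSpace Y]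
    [BorelSpace Y] (hU : P.IsCoding U) {ν : Measure Y} (hν : ν.map hU.factor = μ) :
    hU.sec ∘ hU.factor =ᵐ[ν] id := by
  have hnull : ∀ n i, ∀ᵐ y ∂ν, hU.factor y ∉ frontier (P.Y n i) := fun n i => by
    have h : ν (hU.factor ⁻¹' frontier (P.Y n i)) = 0 := by
      rw [← Measure.map_apply hU.continuous_factor.measurable isClosed_frontier.measurableSet,
        hν, P.frontier_null n i]
    exact measure_eq_zero_iff_ae_notMem.1 h
  filter_upwards [ae_all_iff.2 fun n => ae_all_iff.2 (hnull n)] with y hy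
  refine (hU.separates _ _ fun n i hi => hU.sec_mem ?_).symm
  by_contra hni
  exact hy n i ⟨hU.factor_mem hi, fun h => hni (interior_subset h)⟩

theorem hasUniqueInvariantMeasure [BorelSpace X] [CompactSpace X] [CompactSpace Y]
    [MeasurableSpace Y] [BorelSpace Y] (hU : P.IsCoding U) [IsProbabilityMeasure μ]
    (hψ : ∀ n i k, P.Y (n + 1) k ⊆ α j ⁻¹' P.Y n i → U (n + 1) k ⊆ ψ ⁻¹' U n i)
    (hμ : IsInvariantMeasure (α j) μ) (hα : HasUniqueInvariantMeasure (α j)) :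
    HasUniqueInvariantMeasure ψ := by
  have hs := hU.measurable_sec
  have hf := hU.continuous_factor.measurable
  refine ⟨μ.map hU.sec, ⟨Measure.isProbabilityMeasure_map hs.aemeasurable, ?_⟩, ?_⟩
  · rw [isInvariantMeasure_iff_map_eq] at hμ ⊢
    have hcomm : ψ ∘ hU.sec = hU.sec ∘ α j := funext fun x => (hU.sec_semiconj hψ x).symm
    rw [Measure.map_map ψ.measurable hs, hcomm, ← Measure.map_map hs (α j).measurable, hμ]
  · rintro ν ⟨hν, hνψ⟩
    rw [isInvariantMeasure_iff_map_eq] at hνψ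
    have hcomm : α j ∘ hU.factor = hU.factor ∘ ψ := funext fun y => (hU.factor_semiconj hψ y).symm
    have hmap : ν.map hU.factor = μ := by
      refine hα.unique ⟨Measure.isProbabilityMeasure_map hf.aemeasurable, ?_⟩ ⟨‹_›, hμ⟩
      rw [isInvariantMeasure_iff_map_eq, Measure.map_map (α j).measurable hf, hcomm,
        ← Measure.map_map hf ψ.measurable, hνψ]
    calc ν = (ν.map hU.factor).map hU.sec := by
          rw [Measure.map_map hs hf, Measure.map_congr (hU.sec_factor_ae_eq hmap), Measure.map_id]
      _ = μ.map hU.sec := congrArg (Measure.map hU.sec) hmap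

end Dynamics

end CantorPartition.IsCoding

/-! ### Relations between the projections and the unitaries -/

namespace CantorModel

variable {X : Type*} [MetricSpace X] [MeasurableSpace X] {d : ℕ}
  {α : Fin d → X ≃ₜ X} {μ : Measure X} {P : CantorPartition α μ}
  {A : Type*} [CStarAlgebra A] (M : CantorModel P A)

theorem mul_e_of_subset {n m : ℕ} (h : n ≤ m) {i : Fin (P.l n)} {k : Fin (P.l m)}
    (hki : P.Y m k ⊆ P.Y n i) : M.e n i * M.e m k = M.e m k := by
  induction m, h using Nat.le_induction with
  | base =>
    rw [P.eq_of_mem (P.pt_mem n k) (hki (P.pt_mem n k))]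
    exact (M.e_proj n i).isIdempotentElem
  | succ m hm ih =>
    obtain ⟨k', hk'⟩ := P.refines m k
    rw [← M.e_nested m k' k hk', ← mul_assoc,
      ih (P.subset_of_mem hm (hki (P.pt_mem _ k)) (hk' (P.pt_mem _ k)))]

theorem mul_e_of_not_subset {n m : ℕ} (h : n ≤ m) {i : Fin (P.l n)} {k : Fin (P.l m)}
    (hki : ¬ P.Y m k ⊆ P.Y n i) : M.e n i * M.e m k = 0 := by
  obtain ⟨i', hi'⟩ := P.exists_subset h k
  rw [← M.mul_e_of_subset h hi', ← mul_assoc,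
    M.e_orth n i i' fun hii => hki (hii ▸ hi'), zero_mul]

theorem e_mul_of_subset {n m : ℕ} (h : n ≤ m) {i : Fin (P.l n)} {k : Fin (P.l m)}
    (hki : P.Y m k ⊆ P.Y n i) : M.e m k * M.e n i = M.e m k := by
  simpa [(M.e_proj _ _).isSelfAdjoint.star_eq] using congrArg star (M.mul_e_of_subset h hki)

theorem e_ne_zero [IsFiniteMeasure μ] (hpos : ∀ O : Set X, IsOpen O → O.Nonempty → 0 < μ O)
    (n : ℕ) (i : Fin (P.l n)) : M.e n i ≠ 0 := by
  intro h
  have htr := M.e_trace n i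
  rw [h, map_zero, eq_comm, Complex.ofReal_eq_zero, measureReal_eq_zero_iff] at htr
  exact ((hpos _ isOpen_interior (P.nonempty_interior n i)).trans_le
    (measure_mono interior_subset)).ne' htr

theorem sum_e_mul {n m : ℕ} (h : n ≤ m) (k : Fin (P.l m)) :
    (∑ i, M.e n i) * M.e m k = M.e m k := by
  obtain ⟨i, hi⟩ := P.exists_subset h k
  rw [Finset.sum_mul, Finset.sum_eq_single i, M.mul_e_of_subset h hi]
  · exact fun i' _ hne => M.mul_e_of_not_subset h fun hi' =>
      hne (P.eq_of_mem (hi' (P.pt_mem m k)) (hi (P.pt_mem m k)))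
  · simp

/-- If the maps `f ↦ ∑ i, f (x_{n,i}) e_{n,i}` converge to a unital map, then the projections of
each level add up to the unit. -/
theorem sum_e_eq_one (h : Tendsto (fun n : ℕ => M.approx n 1) atTop (𝓝 1)) (n : ℕ) :
    ∑ i, M.e n i = 1 := by
  have happ : ∀ m, M.approx m 1 = ∑ i, M.e m i := fun m => by simp [approx]
  simp only [happ] at h
  -- For `m ≥ n` this product equals the level `m` sum, which tends to `1`.
  have hmul : Tendsto (fun m => (∑ i, M.e n i) * ∑ k, M.e m k) atTop (𝓝 (∑ i, M.e n i)) := by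
    simpa using h.const_mul (∑ i, M.e n i)
  refine tendsto_nhds_unique (hmul.congr' ?_) h
  filter_upwards [eventually_ge_atTop n] with m hm
  rw [Finset.mul_sum]
  exact Finset.sum_congr rfl fun k _ => M.sum_e_mul hm k

/-- `e_{n,i}` is the sum of the `e_{m,k}` below it, so the identity may be checked on each of them.
-/
theorem e_mul_eq_of_forall (hsum : ∀ n, ∑ i, M.e n i = 1) {n m : ℕ} (h : n ≤ m) {i : Fin (P.l n)}
    {a : A} (ha : ∀ k, P.Y m k ⊆ P.Y n i → M.e m k * a = M.e m k) : M.e n i * a = M.e n i := by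
  have hs : ∑ k, M.e n i * M.e m k = M.e n i := by rw [← Finset.mul_sum, hsum, mul_one]
  nth_rw 1 [← hs]
  rw [Finset.sum_mul]
  refine Eq.trans (Finset.sum_congr rfl fun k _ => ?_) hs
  by_cases hk : P.Y m k ⊆ P.Y n i
  · rw [M.mul_e_of_subset h hk, ha k hk]
  · rw [M.mul_e_of_not_subset h hk, zero_mul]

theorem e_mul_pullback {n : ℕ} {i : Fin (P.l n)} {j : Fin d} {k : Fin (P.l (n + 1))}
    (hk : P.Y (n + 1) k ⊆ α j ⁻¹' P.Y n i) :
    M.e (n + 1) k * P.pullback M.e n i j = M.e (n + 1) k := by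
  rw [CantorPartition.pullback, Finset.mul_sum, Finset.sum_eq_single k,
    (M.e_proj _ _).isIdempotentElem]
  · exact fun k' _ hne => M.e_orth _ _ _ hne.symm
  · exact fun hk' => absurd (by simpa using hk) hk'

/-- The unitaries `u_{j,t}`, `t ≥ n`, conjugate `e_{n,i}` to a projection that dominates
`e_{n+1,k}` whenever `Y_{n+1,k} ⊆ α_j⁻¹(Y_{n,i})`. -/
theorem e_mul_conj (hsum : ∀ n, ∑ i, M.e n i = 1) {n : ℕ} {i : Fin (P.l n)} {j : Fin d}
    {k : Fin (P.l (n + 1))} (hk : P.Y (n + 1) k ⊆ α j ⁻¹' P.Y n i) {t : ℝ} (ht : (n : ℝ) ≤ t) :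
    M.e (n + 1) k * (star (M.u j t) * M.e n i * M.u j t) = M.e (n + 1) k := by
  have ht₀ : 0 ≤ t := n.cast_nonneg.trans ht
  -- Conjugation by `u_{j,t}` is prescribed only at level `m = ⌊t⌋`. So `e_{n+1,k}` is cut into
  -- level `m + 1` projections, each dominated by a conjugate of some `e_{m,p} ≤ e_{n,i}`.
  set m := ⌊t⌋₊
  have hnm : n ≤ m := Nat.le_floor ht
  refine M.e_mul_eq_of_forall hsum (Nat.succ_le_succ hnm) fun k' hk' => ?_
  obtain ⟨p, hp⟩ := P.refines_preimage m j k'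
  have hpi : P.Y m p ⊆ P.Y n i :=
    P.subset_of_mem hnm (hk (hk' (P.pt_mem _ k'))) (hp (P.pt_mem _ k'))
  have hconj := M.u_conj m p j t (Nat.floor_le ht₀) (Nat.lt_floor_add_one t).le
  have hmul : M.e (m + 1) k' * (star (M.u j t) * M.e m p * M.u j t) = M.e (m + 1) k' := by
    rw [hconj, M.e_mul_pullback hp]
  have huu : M.u j t * star (M.u j t) = 1 := (Unitary.mem_iff.1 (M.u_unitary j t ht₀)).2
  have hcomp : (star (M.u j t) * M.e m p * M.u j t) * (star (M.u j t) * M.e n i * M.u j t) =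
      star (M.u j t) * M.e m p * M.u j t := by
    calc _ = star (M.u j t) * M.e m p * (M.u j t * star (M.u j t)) * M.e n i * M.u j t := by
          simp only [mul_assoc]
      _ = star (M.u j t) * (M.e m p * M.e n i) * M.u j t := by
          rw [huu]; simp only [mul_assoc, one_mul]
      _ = _ := by rw [M.e_mul_of_subset hnm hpi]
  nth_rw 1 [← hmul]
  rw [mul_assoc, hcomp, hmul]

/-! ### Transfer to the spectrum `Y` of `C₀₀` -/

section Spectrum

variable {Y : Type*} [TopologicalSpace Y] {h₂ : C(Y, ℂ) →⋆ₐ[ℂ] A}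
  {g : (n : ℕ) → Fin (P.l n) → C(Y, ℂ)}

/-- The domination in `e_mul_conj` holds for all `t ≥ n`, so it survives the limit and becomes a
pointwise identity of functions on `Y`. -/
theorem subset_preimage (h₂_inj : Function.Injective h₂)
    (hg : ∀ n i, h₂ (g n i) = M.e n i) (hsum : ∀ n, ∑ i, M.e n i = 1) {j : Fin d} {ψ : Y ≃ₜ Y}
    (hψ : ∀ f : C(Y, ℂ), Tendsto (fun t : ℝ => star (M.u j t) * h₂ f * M.u j t) atTop
      (𝓝 (h₂ (f.comp ⟨ψ, ψ.continuous⟩))))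
    (n : ℕ) (i : Fin (P.l n)) (k : Fin (P.l (n + 1))) (hk : P.Y (n + 1) k ⊆ α j ⁻¹' P.Y n i) :
    {y : Y | g (n + 1) k y = 1} ⊆ ψ ⁻¹' {y : Y | g n i y = 1} := by
  have hlim : M.e (n + 1) k * h₂ ((g n i).comp ⟨ψ, ψ.continuous⟩) = M.e (n + 1) k := by
    refine tendsto_nhds_unique ((hψ (g n i)).const_mul (M.e (n + 1) k))
      (tendsto_const_nhds.congr' ?_)
    filter_upwards [eventually_ge_atTop (n : ℝ)] with t ht
    rw [hg, M.e_mul_conj hsum hk ht]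
  rw [← hg, ← map_mul] at hlim
  intro y hy
  have := DFunLike.congr_fun (h₂_inj hlim) y
  simpa [show g (n + 1) k y = 1 from hy] using this

variable [CompactSpace Y] [T2Space Y]

/-- The functions that correspond to the projections `e_{n,i}` separate the points of the spectrum
of `C₀₀`. -/
theorem eq_of_forall_eq (h₂_inj : Function.Injective h₂) (h₂_range : h₂.range = M.C00)
    (hg : ∀ n i, h₂ (g n i) = M.e n i) {y z : Y} (h : ∀ n i, g n i y = g n i z) : y = z := by
  -- `K` is a closed ⋆-subalgebra and `h₂` is isometric, so its image is closed. Containing all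
  -- `e_{n,i}`, it contains `C₀₀`; hence no continuous function separates `y` from `z`.
  set K := StarAlgHom.equalizer (ContinuousMap.evalStarAlgHom ℂ ℂ y)
    (ContinuousMap.evalStarAlgHom ℂ ℂ z)
  have hKclosed : IsClosed (K : Set C(Y, ℂ)) :=
    isClosed_eq (continuous_eval_const y) (continuous_eval_const z)
  have hle : M.C00 ≤ K.map h₂ := by
    refine StarSubalgebra.topologicalClosure_minimal (StarAlgebra.adjoin_le ?_) ?_
    · rintro _ ⟨n, i, rfl⟩
      exact ⟨g n i, h n i, hg n i⟩
    · exact (NonUnitalStarAlgHom.isometry h₂ h₂_inj).isClosedEmbedding.isClosedMap _ hKclosed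
  have hall : ∀ f : C(Y, ℂ), f y = f z := fun f => by
    obtain ⟨f', hf', hff⟩ := hle (h₂_range ▸ ⟨f, rfl⟩ : h₂ f ∈ M.C00)
    exact h₂_inj hff ▸ hf'
  by_contra hyz
  obtain ⟨f, hf₀, hf₁, -⟩ := exists_continuous_zero_one_of_isClosed (isClosed_singleton (x := y))
    (isClosed_singleton (x := z)) (disjoint_singleton.2 hyz)
  have := hall ⟨fun w => (f w : ℂ), by fun_prop⟩
  simp [hf₀ rfl, hf₁ rfl] at this

theorem isCoding (h₂_inj : Function.Injective h₂) (h₂_range : h₂.range = M.C00)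
    (hg : ∀ n i, h₂ (g n i) = M.e n i) (hne : ∀ n i, M.e n i ≠ 0) (hsum : ∀ n, ∑ i, M.e n i = 1) :
    P.IsCoding fun n i => {y : Y | g n i y = 1} := by
  have h01 : ∀ n i y, g n i y = 0 ∨ g n i y = 1 := fun n i y => by
    have : g n i * g n i = g n i := h₂_inj <| by
      rw [map_mul, hg, (M.e_proj n i).isIdempotentElem]
    exact IsIdempotentElem.iff_eq_zero_or_one.1 (DFunLike.congr_fun this y)
  have huniq : ∀ {n i k y}, g n i y = 1 → g n k y = 1 → i = k := fun {n i k y} hi hk => by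
    by_contra hik
    have : g n i * g n k = 0 := h₂_inj <| by rw [map_mul, hg, hg, M.e_orth n i k hik, map_zero]
    have := DFunLike.congr_fun this y
    simp [hi, hk] at this
  have hex : ∀ n y, ∃ i, g n i y = 1 := fun n y => by
    by_contra! hcon
    have : ∑ i, g n i = 1 := h₂_inj <| by simp only [map_sum, hg, hsum, map_one]
    have := DFunLike.congr_fun this y
    simp [(h01 _ _ _).resolve_right (hcon _)] at this
  refine ⟨fun n i => ⟨isClosed_eq (g n i).continuous continuous_const, ?_⟩, fun n i => ?_,
    huniq, hex, fun n i k hki y hy => ?_, fun y z hyz => ?_⟩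
  · have : {y : Y | g n i y = 1} = {y | g n i y ≠ 0} := by
      ext y
      rcases h01 n i y with h | h <;> simp [h]
    rw [this]
    exact isOpen_ne_fun (g n i).continuous continuous_const
  · by_contra hempty
    refine hne n i ?_
    have : g n i = 0 := ContinuousMap.ext fun y =>
      (h01 n i y).resolve_right fun h => hempty ⟨y, h⟩
    rw [← hg, this, map_zero]
  · have : g n i * g (n + 1) k = g (n + 1) k := h₂_inj <| by
      rw [map_mul, hg, hg, M.e_nested n i k hki]
    have := DFunLike.congr_fun this y
    simpa [show g (n + 1) k y = 1 from hy] using this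
  · refine M.eq_of_forall_eq h₂_inj h₂_range hg fun n i => ?_
    obtain ⟨k, hk⟩ := hex n y
    have hk' : g n k z = 1 := hyz n k hk
    by_cases hik : i = k
    · rw [hik, hk, hk']
    · rw [(h01 n i y).resolve_right fun h => hik (huniq h hk),
        (h01 n i z).resolve_right fun h => hik (huniq h hk')]

end Spectrum

end CantorModel

theorem mainTheorem6 {X : Type*} [MetricSpace X] [CompactSpace X] [MeasurableSpace X] [BorelSpace X]
    {d : ℕ} [NeZero d] (α : Fin d → X ≃ₜ X)
    (hcomm : ∀ i j : Fin d, ∀ x : X, α i (α j x) = α j (α i x))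
    -- a strictly positive invariant Borel probability measure
    (μ : Measure X) [IsProbabilityMeasure μ]
    (hpos : ∀ O : Set X, IsOpen O → O.Nonempty → 0 < μ O)
    (hinv : ∀ j : Fin d, IsInvariantMeasure (α j) μ)
    -- the construction of the AF-algebra `C₀` and of `C₀₀`
    (P : CantorPartition α μ) {C₀ : Type*} [CStarAlgebra C₀] (M : CantorModel P C₀)
    -- `C₀₀ ≅ C(Y)`
    {Y : Type*} [TopologicalSpace Y] [CompactSpace Y] [T2Space Y] [MeasurableSpace Y] [BorelSpace Y]
    (h₂ : C(Y, ℂ) →⋆ₐ[ℂ] C₀) (h₂_inj : Function.Injective h₂) (h₂_range : h₂.range = M.C00)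
    -- `h₁` is the limit of the maps `h_n`
    (h₁ : C(X, ℂ) →⋆ₐ[ℂ] C(Y, ℂ))
    (h₁_lim : ∀ f : C(X, ℂ), Tendsto (fun n : ℕ => M.approx n f) atTop (𝓝 (h₂ (h₁ f))))
    -- `β_j` is the homeomorphism that induces `β_j^* = lim_t ad u_{j,t}`
    (β : Fin d → Y ≃ₜ Y)
    (β_lim : ∀ (j : Fin d) (g : C(Y, ℂ)),
      Tendsto (fun t : ℝ => star (M.u j t) * h₂ g * M.u j t) atTop
        (𝓝 (h₂ (g.comp ⟨β j, (β j).continuous⟩)))) :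
    (IsMinimalHomeo (α 0) →
      IsMinimalHomeo (β 0) ∧ (Infinite X → Nonempty (Y ≃ₜ cantorSet))) ∧
    (HasUniqueInvariantMeasure (α 0) → HasUniqueInvariantMeasure (β 0)) := by
  have hsum : ∀ n, ∑ i, M.e n i = 1 := M.sum_e_eq_one (by simpa using h₁_lim 1)
  have hmem : ∀ n i, ∃ g : C(Y, ℂ), h₂ g = M.e n i := fun n i => by
    have : M.e n i ∈ h₂.range := h₂_range ▸
      StarSubalgebra.le_topologicalClosure _ (StarAlgebra.subset_adjoin ℂ _ ⟨n, i, rfl⟩)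
    exact this
  choose g hg using hmem
  have hU := M.isCoding h₂_inj h₂_range hg (M.e_ne_zero hpos) hsum
  have hψ := M.subset_preimage h₂_inj hg hsum (β_lim 0)
  exact ⟨fun hα => ⟨hU.isMinimalHomeo hψ hα, fun _ => hU.nonempty_homeomorph_cantorSet hψ hα⟩,
    hU.hasUniqueInvariantMeasure hψ (hinv 0)⟩
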